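/- Let $G$ be an ample étale groupoid, i.e. a topological groupoid (multiplication and inversion are continuous) whose source map $d\colon G\to G^{(0)}$ is a local homeomorphism and whose topology has a basis of compact open sets; assume that the unit space $G^{(0)}$ is Hausdorff ($G$ itself need not be). A subgroupoid of $G$ (a subset closed under multiplication and inversion) is called wide if it contains $G^{(0)}$. A compact bisection of $G$ is a compact open set $U\subset G$ such that the restrictions to $U$ of the source map $d$ and of the range map $r$ are homeomorphisms onto their images. Let $I(G)$ be the set of all compact bisections of $G$; it is an inverse semigroup with zero $\emptyset$ under the product $UV=\{\alpha\beta\mid \alpha\in U,\ \beta\in V,\ d(\alpha)=r(\beta)\}$, with inverses $U^{-1}=\{\alpha^{-1}\mid\alpha\in U\}$. A subsemigroup of $I(G)$ means a subset closed under product and inverse. It is called wide if it contains all idempotents of $I(G)$, and join closed if, whenever $U,V$ are elements of it that are compatible (i.e. $U^{-1}V$ and $UV^{-1}$ are idempotent), it also contains their join (their least upper bound in the natural partial order of $I(G)$, where $U\le V$ means $VU^{-1}U=U$; this join is $U\cup V$). Then there is a one-to-one correspondence between the set of all open wide subgroupoids $H$ of $G$ and the set of all wide join closed subsemigroups $T$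 of $I(G)$. It is given by the mutually inverse maps $$H\longmapsto \{U\in I(G)\mid U\subset H\},\qquad T\longmapsto \bigcup_{U\in T}U .$$ -/

import Mathlib

/-! ## Inverse semigroups -/

/-- An inverse semigroup with zero: every `s` has a unique generalized inverse `s⁻¹`. -/
class InverseSemigroup (S : Type*) extends SemigroupWithZero S, Inv S where
  mul_inv_mul : ∀ s : S, s * s⁻¹ * s = s
  inv_mul_inv : ∀ s : S, s⁻¹ * s * s⁻¹ = s⁻¹
  inv_unique : ∀ s t : S, s * t * s = s → t * s * t = t → t = s⁻¹

namespace InverseSemigroup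

variable {S : Type*} [InverseSemigroup S]

/-- The natural partial order of an inverse semigroup. -/
def NatLE (s t : S) : Prop := t * s⁻¹ * s = s

/-- `s` and `t` are compatible if `s⁻¹ t` and `s t⁻¹` are idempotents. -/
def Compatible (s t : S) : Prop := IsIdempotentElem (s⁻¹ * t) ∧ IsIdempotentElem (s * t⁻¹)

/-- `u` is the join (least upper bound) of `s` and `t` for the natural partial order. -/
def IsJoin (s t u : S) : Prop :=
  NatLE s u ∧ NatLE t u ∧ ∀ w : S, NatLE s w → NatLE t w → NatLE u w

end InverseSemigroup

/-- A subsemigroup of an inverse semigroup: a subset closed under product and inverse. -/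
structure InverseSubsemigroup (S : Type*) [InverseSemigroup S] extends Subsemigroup S where
  inv_mem' : ∀ {s : S}, s ∈ carrier → s⁻¹ ∈ carrier

namespace InverseSubsemigroup

variable {S : Type*} [InverseSemigroup S]

instance : SetLike (InverseSubsemigroup S) S where
  coe T := T.carrier
  coe_injective := by
    rintro ⟨⟨A, _⟩, _⟩ ⟨⟨B, _⟩, _⟩ h
    have : A = B := h
    subst this
    rfl

/-- A subsemigroup is wide if it contains all idempotents. -/
def IsWide (T : InverseSubsemigroup S) : Prop := ∀ e : S, IsIdempotentElem e → e ∈ T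

/-- A subsemigroup is join closed if it contains all joins of its compatible pairs. -/
def IsJoinClosed (T : InverseSubsemigroup S) : Prop :=
  ∀ s ∈ T, ∀ t ∈ T, InverseSemigroup.Compatible s t →
    ∀ u : S, InverseSemigroup.IsJoin s t u → u ∈ T

end InverseSubsemigroup

/-! ## Groupoids and their topologies -/

/-- A groupoid given by its set of arrows `G` with distinguished subset `units` of units, source
map `d`, range map `r`, and a product `mul a b` defined whenever `d a = r b`. -/
class ArrowGroupoid (G : Type*) where
  units : Set G
  d : G → units
  r : G → units
  mul : (a b : G) → d a = r b → G
  inv : G → G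
  d_unit : ∀ x : units, d x = x
  r_unit : ∀ x : units, r x = x
  mul_d : ∀ (a : G) (h : d a = r (d a)), mul a (d a) h = a
  r_mul : ∀ (a : G) (h : d (r a) = r a), mul (r a) a h = a
  d_mul : ∀ (a b : G) (h : d a = r b), d (mul a b h) = d b
  r_mul' : ∀ (a b : G) (h : d a = r b), r (mul a b h) = r a
  assoc : ∀ (a b c : G) (hab : d a = r b) (hbc : d b = r c)
    (h₁ : d (mul a b hab) = r c) (h₂ : d a = r (mul b c hbc)),
    mul (mul a b hab) c h₁ = mul a (mul b c hbc) h₂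
  d_inv : ∀ a : G, d (inv a) = r a
  r_inv : ∀ a : G, d a = r (inv a)
  inv_mul : ∀ a : G, mul (inv a) a (d_inv a) = d a
  mul_inv : ∀ a : G, mul a (inv a) (r_inv a) = r a

/-- The unit space of `G`, with the subspace topology when `G` has a topology. -/
abbrev UnitSpace (G : Type*) [ArrowGroupoid G] : Type _ := (ArrowGroupoid.units : Set G)

/-- A subset of a groupoid closed under the product and the inverse. -/
structure ArrowSubgroupoid (G : Type*) [ArrowGroupoid G] where
  carrier : Set G
  mul_mem : ∀ {a b : G} (h : ArrowGroupoid.d a = ArrowGroupoid.r b),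
    a ∈ carrier → b ∈ carrier → ArrowGroupoid.mul a b h ∈ carrier
  inv_mem : ∀ {a : G}, a ∈ carrier → ArrowGroupoid.inv a ∈ carrier

namespace ArrowSubgroupoid

variable {G : Type*} [ArrowGroupoid G]

instance : SetLike (ArrowSubgroupoid G) G where
  coe H := H.carrier
  coe_injective := by
    rintro ⟨A, _, _⟩ ⟨B, _, _⟩ h
    have : A = B := h
    subst this
    rfl

/-- A subgroupoid is wide if it contains all units. -/
def IsWide (H : ArrowSubgroupoid G) : Prop := ∀ x ∈ (ArrowGroupoid.units : Set G), x ∈ H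

end ArrowSubgroupoid

/-- A groupoid with a topology for which product and inverse are continuous. -/
class TopologicalGroupoid (G : Type*) [TopologicalSpace G] [ArrowGroupoid G] : Prop where
  continuous_mul : Continuous
    fun p : {p : G × G // ArrowGroupoid.d p.1 = ArrowGroupoid.r p.2} =>
      ArrowGroupoid.mul p.1.1 p.1.2 p.2
  continuous_inv : Continuous (ArrowGroupoid.inv : G → G)

/-- A topological groupoid is étale if its source map is a local homeomorphism. -/
class EtaleGroupoid (G : Type*) [TopologicalSpace G] [ArrowGroupoid G] : Prop
    extends TopologicalGroupoid G where
  isLocalHomeomorph_d : IsLocalHomeomorph (ArrowGroupoid.d : G → UnitSpace G)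

/-- An étale groupoid is ample if its topology has a basis of compact open sets. -/
class AmpleGroupoid (G : Type*) [TopologicalSpace G] [ArrowGroupoid G] : Prop
    extends EtaleGroupoid G where
  exists_compact_basis : ∃ B : Set (Set G),
    TopologicalSpace.IsTopologicalBasis B ∧ ∀ U ∈ B, IsCompact U

/-! ## Compact bisections -/

/-- An open set on which source and range are homeomorphisms onto their images. -/
structure IsBisection {G : Type*} [TopologicalSpace G] [ArrowGroupoid G] (U : Set G) : Prop where
  isOpen : IsOpen U
  isEmbedding_d : Topology.IsEmbedding (U.domRestrict (ArrowGroupoid.d : G → UnitSpace G))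
  isEmbedding_r : Topology.IsEmbedding (U.domRestrict (ArrowGroupoid.r : G → UnitSpace G))

/-- The set `I(G)` of compact bisections of `G`. -/
structure CompactBisection (G : Type*) [TopologicalSpace G] [ArrowGroupoid G] where
  carrier : Set G
  isCompact : IsCompact carrier
  isBisection : IsBisection carrier

namespace ArrowGroupoid

variable {G : Type*} [ArrowGroupoid G]

/-- The product `UV` of two subsets of a groupoid. -/
def setMul (U V : Set G) : Set G :=
  {c | ∃ a ∈ U, ∃ b ∈ V, ∃ h : d a = r b, c = mul a b h}

/-- The set `U⁻¹` of inverses of elements of `U`. -/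
def setInv (U : Set G) : Set G := inv '' U

theorem mul_congr {a a' b b' : G} (ha : a = a') (hb : b = b') (h : d a = r b)
    (h' : d a' = r b') : mul a b h = mul a' b' h' := by
  subst ha hb
  rfl

theorem inv_mul_cancel_left (a b : G) (h : d a = r b)
    (h' : d (inv a) = r (mul a b h)) : mul (inv a) (mul a b h) h' = b := by
  have h1 : d (mul (inv a) a (d_inv a)) = r b := (d_mul _ _ _).trans h
  rw [← assoc (inv a) a b (d_inv a) h h1 h']
  have h2 : d (r b : G) = r b := d_unit _
  exact (mul_congr ((inv_mul a).trans (congrArg Subtype.val h)) rfl h1 h2).trans (r_mul b h2)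

theorem mul_inv_cancel_left (a b : G) (h : d (inv a) = r b)
    (h' : d a = r (mul (inv a) b h)) : mul a (mul (inv a) b h) h' = b := by
  have h1 : d (mul a (inv a) (r_inv a)) = r b := (d_mul _ _ _).trans h
  rw [← assoc a (inv a) b (r_inv a) h h1 h']
  have h2 : d (r b : G) = r b := d_unit _
  have h3 : r a = r b := (d_inv a).symm.trans h
  exact (mul_congr ((mul_inv a).trans (congrArg Subtype.val h3)) rfl h1 h2).trans (r_mul b h2)

theorem eq_inv_of_mul_eq (a b : G) (h : d a = r b) (e : mul a b h = r a) : b = inv a := by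
  have h' : d (inv a) = r (mul a b h) := (d_inv a).trans (r_mul' a b h).symm
  rw [← inv_mul_cancel_left a b h h']
  have h2 : d (inv a) = r (d (inv a) : G) := (r_unit _).symm
  exact (mul_congr rfl (e.trans (congrArg Subtype.val (d_inv a).symm)) h' h2).trans (mul_d _ h2)

theorem inv_inv (a : G) : inv (inv a) = a :=
  (eq_inv_of_mul_eq (inv a) a (d_inv a)
    ((inv_mul a).trans (congrArg Subtype.val (r_inv a)))).symm

theorem setInv_eq (U : Set G) : setInv U = inv ⁻¹' U := by
  ext a
  constructor
  · rintro ⟨b, hb, rfl⟩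
    simpa [inv_inv] using hb
  · intro h
    exact ⟨inv a, h, inv_inv a⟩

theorem setMul_assoc (U V W : Set G) : setMul (setMul U V) W = setMul U (setMul V W) := by
  ext x
  constructor
  · rintro ⟨_, ⟨a, ha, b, hb, hab, rfl⟩, c, hc, h, rfl⟩
    have hbc : d b = r c := (d_mul a b hab).symm.trans h
    have h2 : d a = r (mul b c hbc) := hab.trans (r_mul' b c hbc).symm
    exact ⟨a, ha, _, ⟨b, hb, c, hc, hbc, rfl⟩, h2, assoc _ _ _ _ _ _ _⟩
  · rintro ⟨a, ha, _, ⟨b, hb, c, hc, hbc, rfl⟩, h, rfl⟩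
    have hab : d a = r b := h.trans (r_mul' b c hbc)
    have h1 : d (mul a b hab) = r c := (d_mul a b hab).trans hbc
    exact ⟨_, ⟨a, ha, b, hb, hab, rfl⟩, c, hc, h1, (assoc _ _ _ _ _ _ _).symm⟩

theorem r_eq : (r : G → (units : Set G)) = d ∘ inv := by
  funext a
  exact (d_inv a).symm

/-- If `a = (a b) a` then `b` is the inverse of `a`. -/
theorem eq_inv_of_mul_mul_eq (a b : G) (h : d a = r b) (h' : d (mul a b h) = r a)
    (e : mul (mul a b h) a h' = a) : b = inv a := by
  apply eq_inv_of_mul_eq a b h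
  have hba : d b = r a := (d_mul a b h).symm.trans h'
  have h2 : d a = r (mul b a hba) := h.trans (r_mul' _ _ _).symm
  rw [assoc a b a h hba h' h2] at e
  have h3 : d (inv a) = r (mul a (mul b a hba) h2) := (d_inv a).trans (r_mul' _ _ _).symm
  have e1 : mul b a hba = mul (inv a) a (d_inv a) :=
    (inv_mul_cancel_left a (mul b a hba) h2 h3).symm.trans (mul_congr rfl e h3 (d_inv a))
  have h4 : d (mul b a hba) = r (inv a) := (d_mul _ _ _).trans (r_inv a)
  have h5 : d b = r (mul a (inv a) (r_inv a)) := hba.trans (r_mul' _ _ _).symm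
  have h6 : d b = r (d b : G) := (r_unit _).symm
  have e2 : mul (mul b a hba) (inv a) h4 = b := by
    rw [assoc b a (inv a) hba (r_inv a) h4 h5]
    exact (mul_congr rfl ((mul_inv a).trans (congrArg Subtype.val hba.symm)) h5 h6).trans
      (mul_d b h6)
  have h7 : d (mul (inv a) a (d_inv a)) = r (inv a) := (d_mul _ _ _).trans (r_inv a)
  have h8 : d (r (inv a) : G) = r (inv a) := d_unit _
  have e3 : b = inv a := e2.symm.trans ((mul_congr e1 rfl h4 h7).trans
    ((mul_congr ((inv_mul a).trans (congrArg Subtype.val (r_inv a))) rfl h7 h8).trans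
      (r_mul (inv a) h8)))
  subst e3
  exact mul_inv a

end ArrowGroupoid

namespace EtaleGroupoid

open ArrowGroupoid

variable {G : Type*} [TopologicalSpace G] [ArrowGroupoid G] [EtaleGroupoid G]

theorem continuous_d : Continuous (d : G → UnitSpace G) :=
  (isLocalHomeomorph_d (G := G)).continuous

theorem isOpenMap_d : IsOpenMap (d : G → UnitSpace G) :=
  (isLocalHomeomorph_d (G := G)).isOpenMap

theorem isOpen_setInv {U : Set G} (hU : IsOpen U) : IsOpen (setInv U) := by
  rw [setInv_eq]
  exact hU.preimage TopologicalGroupoid.continuous_inv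

theorem continuous_r : Continuous (r : G → UnitSpace G) := by
  rw [r_eq]
  exact continuous_d.comp TopologicalGroupoid.continuous_inv

theorem isOpenMap_r : IsOpenMap (r : G → UnitSpace G) := by
  rw [r_eq]
  exact isOpenMap_d.comp fun U hU => isOpen_setInv hU

theorem isBisection_iff {U : Set G} : IsBisection U ↔
    IsOpen U ∧ Set.InjOn (d : G → UnitSpace G) U ∧ Set.InjOn (r : G → UnitSpace G) U := by
  constructor
  · rintro ⟨h1, h2, h3⟩
    exact ⟨h1, Set.injOn_iff_injective.2 h2.injective, Set.injOn_iff_injective.2 h3.injective⟩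
  · rintro ⟨h1, h2, h3⟩
    refine ⟨h1, ?_, ?_⟩
    · exact (Topology.IsOpenEmbedding.of_continuous_injective_isOpenMap
        (continuous_d.comp continuous_subtype_val) (Set.injOn_iff_injective.1 h2)
        (isOpenMap_d.comp h1.isOpenMap_subtype_val)).isEmbedding
    · exact (Topology.IsOpenEmbedding.of_continuous_injective_isOpenMap
        (continuous_r.comp continuous_subtype_val) (Set.injOn_iff_injective.1 h3)
        (isOpenMap_r.comp h1.isOpenMap_subtype_val)).isEmbedding

theorem isOpen_setMul {U V : Set G} (hU : IsBisection U) (hV : IsOpen V) :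
    IsOpen (setMul U V) := by
  rw [isOpen_iff_mem_nhds]
  rintro _ ⟨a, ha, b, hb, h, rfl⟩
  have hO : IsOpen ((r : G → UnitSpace G) '' U) := isOpenMap_r U hU.isOpen
  let R : Set G := r ⁻¹' ((r : G → UnitSpace G) '' U)
  have hR : IsOpen R := hO.preimage continuous_r
  choose f hfU hfr using fun x : R => x.2
  have hcf : Continuous f := by
    have h1 : Continuous fun x : R => (⟨f x, hfU x⟩ : U) := by
      rw [hU.isEmbedding_r.continuous_iff]
      have : (U.domRestrict (r : G → UnitSpace G)) ∘ (fun x : R => (⟨f x, hfU x⟩ : U))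
          = fun x : R => r (x : G) := funext hfr
      rw [this]
      exact continuous_r.comp continuous_subtype_val
    exact continuous_subtype_val.comp h1
  have hcomp : ∀ x : R, d (inv (f x)) = r (x : G) := fun x => (d_inv _).trans (hfr x)
  let g : R → G := fun x => mul (inv (f x)) x (hcomp x)
  have hcg : Continuous g :=
    TopologicalGroupoid.continuous_mul.comp
      (((TopologicalGroupoid.continuous_inv.comp hcf).prodMk continuous_subtype_val).subtype_mk hcomp)
  have hx : mul a b h ∈ R := ⟨a, ha, (r_mul' a b h).symm⟩
  have hfa : f ⟨_, hx⟩ = a := by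
    have := hU.isEmbedding_r.injective (a₁ := ⟨f ⟨_, hx⟩, hfU _⟩) (a₂ := ⟨a, ha⟩)
      ((hfr ⟨_, hx⟩).trans (r_mul' a b h))
    exact congrArg Subtype.val this
  have hgb : g ⟨_, hx⟩ = b := by
    have h' : d (inv a) = r (mul a b h) := (d_inv a).trans (r_mul' a b h).symm
    exact (mul_congr (by rw [hfa]) rfl (hcomp ⟨_, hx⟩) h').trans (inv_mul_cancel_left a b h h')
  have hN : IsOpen (Subtype.val '' (g ⁻¹' V)) := hR.isOpenMap_subtype_val _ (hV.preimage hcg)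
  refine Filter.mem_of_superset (hN.mem_nhds ⟨⟨_, hx⟩, ?_, rfl⟩) ?_
  · change g ⟨_, hx⟩ ∈ V
    rwa [hgb]
  · rintro _ ⟨x, hxV, rfl⟩
    have h' : d (f x) = r (g x) := (r_inv _).trans (r_mul' _ _ _).symm
    exact ⟨f x, hfU x, g x, hxV, h', (mul_inv_cancel_left _ _ (hcomp x) h').symm⟩

theorem isCompact_setMul [T2Space (UnitSpace G)] {U V : Set G} (hU : IsCompact U)
    (hV : IsCompact V) : IsCompact (setMul U V) := by
  have hcl : IsClosed {p : G × G | (d p.1 : UnitSpace G) = r p.2} :=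
    isClosed_eq (continuous_d.comp continuous_fst) (continuous_r.comp continuous_snd)
  have hK : IsCompact ((Subtype.val : {p : G × G // d p.1 = r p.2} → G × G) ⁻¹' (U ×ˢ V)) :=
    hcl.isClosedEmbedding_subtypeVal.isCompact_preimage (hU.prod hV)
  convert hK.image TopologicalGroupoid.continuous_mul using 1
  ext c
  constructor
  · rintro ⟨a, ha, b, hb, h, rfl⟩
    exact ⟨⟨(a, b), h⟩, ⟨ha, hb⟩, rfl⟩
  · rintro ⟨⟨⟨a, b⟩, h⟩, ⟨ha, hb⟩, rfl⟩
    exact ⟨a, ha, b, hb, h, rfl⟩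

theorem isBisection_setMul {U V : Set G} (hU : IsBisection U) (hV : IsBisection V) :
    IsBisection (setMul U V) := by
  obtain ⟨-, hUd, hUr⟩ := isBisection_iff.1 hU
  obtain ⟨hVo, hVd, hVr⟩ := isBisection_iff.1 hV
  refine isBisection_iff.2 ⟨isOpen_setMul hU hVo, ?_, ?_⟩
  · rintro _ ⟨a, ha, b, hb, h, rfl⟩ _ ⟨a', ha', b', hb', h', rfl⟩ e
    rw [d_mul, d_mul] at e
    have eb := hVd hb hb' e
    subst eb
    have ea := hUd ha ha' (h.trans h'.symm)
    subst ea
    rfl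
  · rintro _ ⟨a, ha, b, hb, h, rfl⟩ _ ⟨a', ha', b', hb', h', rfl⟩ e
    rw [r_mul', r_mul'] at e
    have ea := hUr ha ha' e
    subst ea
    have eb := hVr hb hb' (h.symm.trans h')
    subst eb
    rfl

theorem isBisection_setInv {U : Set G} (hU : IsBisection U) : IsBisection (setInv U) := by
  obtain ⟨hUo, hUd, hUr⟩ := isBisection_iff.1 hU
  refine isBisection_iff.2 ⟨isOpen_setInv hUo, ?_, ?_⟩
  · rintro _ ⟨a, ha, rfl⟩ _ ⟨a', ha', rfl⟩ e
    rw [d_inv, d_inv] at e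
    rw [hUr ha ha' e]
  · rintro _ ⟨a, ha, rfl⟩ _ ⟨a', ha', rfl⟩ e
    rw [← r_inv, ← r_inv] at e
    rw [hUd ha ha' e]

end EtaleGroupoid

namespace CompactBisection

open ArrowGroupoid EtaleGroupoid

variable {G : Type*} [TopologicalSpace G] [ArrowGroupoid G]

instance : SetLike (CompactBisection G) G where
  coe U := U.carrier
  coe_injective := by
    rintro ⟨A, _, _⟩ ⟨B, _, _⟩ h
    have : A = B := h
    subst this
    rfl

variable [EtaleGroupoid G]

instance : Inv (CompactBisection G) where
  inv U := ⟨setInv U, U.isCompact.image TopologicalGroupoid.continuous_inv,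
    isBisection_setInv U.isBisection⟩

instance : Zero (CompactBisection G) where
  zero := ⟨∅, isCompact_empty, isBisection_iff.2 ⟨isOpen_empty, by simp, by simp⟩⟩

theorem setMul_setInv_self (U : CompactBisection G) :
    setMul (setMul U (setInv U)) U = (U : Set G) := by
  obtain ⟨-, hUd, hUr⟩ := isBisection_iff.1 U.isBisection
  have key : ∀ (a : G) (h : d (mul a (inv a) (r_inv a)) = r a),
      mul (mul a (inv a) (r_inv a)) a h = a := fun a h =>
    (mul_congr (mul_inv a) rfl h (d_unit _)).trans (r_mul a (d_unit _))
  ext x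
  constructor
  · rintro ⟨_, ⟨a, ha, _, ⟨b, hb, rfl⟩, h, rfl⟩, c, hc, h', rfl⟩
    have e1 := hUd ha hb (h.trans (r_inv b).symm)
    subst e1
    have e2 := hUr ha hc (((d_inv a).symm.trans (d_mul _ _ _).symm).trans h')
    subst e2
    rw [key]
    exact ha
  · intro hx
    have h' : d (mul x (inv x) (r_inv x)) = r x := (d_mul _ _ _).trans (d_inv x)
    exact ⟨_, ⟨x, hx, inv x, ⟨x, hx, rfl⟩, r_inv x, rfl⟩, x, hx, h', (key x h').symm⟩

theorem subset_setInv_of_setMul (U V : CompactBisection G)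
    (h : setMul (setMul V U) V = (V : Set G)) : (V : Set G) ⊆ setInv (U : Set G) := by
  obtain ⟨-, hVd, hVr⟩ := isBisection_iff.1 V.isBisection
  intro v hv
  have hv' := hv
  rw [← h] at hv'
  obtain ⟨_, ⟨a, ha, u, hu, h1, rfl⟩, c, hc, h2, e⟩ := hv'
  have ea : v = a := hVr hv ha (by rw [e, r_mul', r_mul'])
  have ec : v = c := hVd hv hc (by rw [e, d_mul])
  subst ea
  subst ec
  rw [setInv_eq]
  change inv v ∈ (U : Set G)
  rw [← eq_inv_of_mul_mul_eq v u h1 h2 e.symm]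
  exact hu

variable [T2Space (UnitSpace G)]

instance : Mul (CompactBisection G) where
  mul U V := ⟨setMul U V, isCompact_setMul U.isCompact V.isCompact,
    isBisection_setMul U.isBisection V.isBisection⟩

instance : InverseSemigroup (CompactBisection G) where
  mul_assoc U V W := SetLike.coe_injective (setMul_assoc _ _ _)
  zero_mul U := SetLike.coe_injective <| Set.eq_empty_of_forall_notMem
    fun _ ⟨_, ha, _⟩ => ha
  mul_zero U := SetLike.coe_injective <| Set.eq_empty_of_forall_notMem
    fun _ ⟨_, _, _, hb, _⟩ => hb
  mul_inv_mul U := SetLike.coe_injective (setMul_setInv_self U)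
  inv_mul_inv U := SetLike.coe_injective <| by
    have h := setMul_setInv_self U⁻¹
    have e : setInv ((U⁻¹ : CompactBisection G) : Set G) = U := by
      change inv '' (inv '' (U : Set G)) = U
      simp [Set.image_image, ArrowGroupoid.inv_inv]
    rw [e] at h
    exact h
  inv_unique U V h1 h2 := SetLike.coe_injective <| by
    apply Set.Subset.antisymm
    · exact subset_setInv_of_setMul U V (congrArg SetLike.coe h2)
    · have h := subset_setInv_of_setMul V U (congrArg SetLike.coe h1)
      rintro _ ⟨a, ha, rfl⟩
      have := h ha
      rw [setInv_eq] at this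
      exact this

end CompactBisection

/-!
Both maps are easily seen to be well defined once the inverse semigroup notions are read off as
properties of sets of arrows: an idempotent compact bisection is one contained in the unit space
(`CompactBisection.isIdempotentElem_iff_subset_units`), the natural partial order is inclusion
(`CompactBisection.natLE_iff`), and two compact bisections are compatible exactly when they agree
over common sources and common ranges, so that their union is a compact bisection and hence their
join (`InverseSemigroup.Compatible.exists_isJoin_union`).

The topology enters through two facts. The unit space is open in an étale groupoid
(`EtaleGroupoid.isOpen_units`), and the compact bisections form a basis of the topology of an
ample groupoid (`AmpleGroupoid.exists_compactBisection`). The basis shows that an open subgroupoid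
`H` is the union of the compact bisections it contains, and together with the openness of the unit
space that the union of a wide `T` is wide.

The remaining point is that a compact bisection `U` contained in the union of a wide join closed
`T` belongs to `T` (`CompactBisection.mem_of_subset_iUnion`). Locally `U` coincides with some
`V ∈ T`, so each point of `U` has a compact bisection `W` as a neighbourhood with `W ⊆ U ∩ V`.
Then `W = V (W⁻¹ W)` is in `T` because `W⁻¹ W` is idempotent. Subsets of the bisection `U` are
pairwise compatible, so joins of finitely many such `W` are again in `T`, and by compactness `U` is
one of these joins.
-/

/-! ### Units of a groupoid -/

namespace ArrowGroupoid

variable {G : Type*} [ArrowGroupoid G]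

theorem coe_d_of_mem_units {a : G} (ha : a ∈ (units : Set G)) : (d a : G) = a :=
  congrArg Subtype.val (d_unit ⟨a, ha⟩)

theorem coe_r_of_mem_units {a : G} (ha : a ∈ (units : Set G)) : (r a : G) = a :=
  congrArg Subtype.val (r_unit ⟨a, ha⟩)

theorem mem_units_of_mul_self {a : G} (h : d a = r a) (e : mul a a h = a) :
    a ∈ (units : Set G) := by
  have h' : d (inv a) = r (mul a a h) := (d_inv a).trans (r_mul' a a h).symm
  have e' : a = d a := (inv_mul_cancel_left a a h h').symm.trans
    ((mul_congr rfl e h' (d_inv a)).trans (inv_mul a))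
  rw [e']
  exact (d a).2

theorem mul_self_of_mem_units {a : G} (ha : a ∈ (units : Set G)) (h : d a = r a) :
    mul a a h = a :=
  (mul_congr rfl (coe_d_of_mem_units ha).symm h (r_unit _).symm).trans (mul_d a _)

theorem eq_inv_of_mul_mem_units {a b : G} (h : d a = r b) (hu : mul a b h ∈ (units : Set G)) :
    b = inv a :=
  eq_inv_of_mul_eq a b h ((coe_r_of_mem_units hu).symm.trans (congrArg Subtype.val (r_mul' a b h)))

theorem eq_of_inv_mul_mem_units {a b : G} (h : d (inv a) = r b)
    (hu : mul (inv a) b h ∈ (units : Set G)) : a = b :=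
  (inv_inv a).symm.trans (eq_inv_of_mul_mem_units h hu).symm

theorem eq_of_mul_inv_mem_units {a b : G} (h : d a = r (inv b))
    (hu : mul a (inv b) h ∈ (units : Set G)) : a = b := by
  have e := congrArg inv (eq_inv_of_mul_mem_units h hu)
  rw [inv_inv, inv_inv] at e
  exact e.symm

theorem mul_inv_mul_cancel_right (a b : G) (h : d a = r (inv b))
    (h' : d (mul a (inv b) h) = r b) : mul (mul a (inv b) h) b h' = a := by
  have h1 : d a = r (mul (inv b) b (d_inv b)) := h.trans (r_mul' _ _ _).symm
  have h2 : d a = r (d a : G) := (r_unit _).symm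
  have hd : d b = d a := (r_inv b).trans h.symm
  rw [assoc a (inv b) b h (d_inv b) h' h1]
  exact (mul_congr rfl ((inv_mul b).trans (congrArg Subtype.val hd)) h1 h2).trans (mul_d a h2)

end ArrowGroupoid

/-! ### Openness of the unit space and the basis of compact bisections -/

open ArrowGroupoid in
/-- Near a unit, an arrow `a` and the unit `d a` lie in a common set on which `d` is injective;
both have source `d a`, so they are equal. -/
theorem EtaleGroupoid.isOpen_units {G : Type*} [TopologicalSpace G] [ArrowGroupoid G]
    [EtaleGroupoid G] : IsOpen (units : Set G) := by
  rw [isOpen_iff_mem_nhds]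
  intro x hx
  obtain ⟨f, hxf, hf⟩ := isLocalHomeomorph_d (G := G) x
  have hc : Continuous fun a : G => (d a : G) := continuous_subtype_val.comp continuous_d
  have hW : IsOpen (f.source ∩ (fun a : G => (d a : G)) ⁻¹' f.source) :=
    f.open_source.inter (f.open_source.preimage hc)
  refine Filter.mem_of_superset (hW.mem_nhds ⟨hxf, ?_⟩) ?_
  · change (d x : G) ∈ f.source
    rwa [coe_d_of_mem_units hx]
  · rintro a ⟨ha, hda⟩
    have hinj : Set.InjOn (d : G → UnitSpace G) f.source := hf ▸ f.injOn
    have e : a = d a := hinj ha hda (d_unit (d a)).symm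
    rw [e]
    exact (d a).2

open ArrowGroupoid EtaleGroupoid in
/-- The compact bisections form a basis of the topology: the range map is injective near `x` because
`d` is injective near `x⁻¹`, so a small enough basic compact open set is a bisection. -/
theorem AmpleGroupoid.exists_compactBisection {G : Type*} [TopologicalSpace G] [ArrowGroupoid G]
    [AmpleGroupoid G] {O : Set G} (hO : IsOpen O) {x : G} (hx : x ∈ O) :
    ∃ U : CompactBisection G, x ∈ (U : Set G) ∧ (U : Set G) ⊆ O := by
  obtain ⟨B, hB, hBc⟩ := exists_compact_basis (G := G)
  obtain ⟨f, hxf, hf⟩ := isLocalHomeomorph_d (G := G) x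
  obtain ⟨g, hxg, hg⟩ := isLocalHomeomorph_d (G := G) (inv x)
  have hfi : Set.InjOn (d : G → UnitSpace G) f.source := hf ▸ f.injOn
  have hgi : Set.InjOn (d : G → UnitSpace G) g.source := hg ▸ g.injOn
  have hN : IsOpen (O ∩ (f.source ∩ inv ⁻¹' g.source)) :=
    hO.inter (f.open_source.inter (g.open_source.preimage TopologicalGroupoid.continuous_inv))
  obtain ⟨U, hUB, hxU, hUN⟩ := hB.exists_subset_of_mem_open
    (show x ∈ O ∩ (f.source ∩ inv ⁻¹' g.source) from ⟨hx, hxf, hxg⟩) hN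
  refine ⟨⟨U, hBc U hUB, isBisection_iff.2 ⟨hB.isOpen hUB, ?_, ?_⟩⟩, hxU, fun a ha => (hUN ha).1⟩
  · exact hfi.mono fun a ha => (hUN ha).2.1
  · intro a ha b hb e
    have e' : inv a = inv b :=
      hgi (hUN ha).2.2 (hUN hb).2.2 ((d_inv a).trans (e.trans (d_inv b).symm))
    rw [← ArrowGroupoid.inv_inv a, e', ArrowGroupoid.inv_inv]

/-! ### The inverse semigroup of compact bisections -/

namespace CompactBisection

open ArrowGroupoid EtaleGroupoid InverseSemigroup

variable {G : Type*} [TopologicalSpace G] [ArrowGroupoid G]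

theorem isOpen_coe (U : CompactBisection G) : IsOpen (U : Set G) := U.isBisection.isOpen

variable [EtaleGroupoid G]

theorem inv_mem_inv {U : CompactBisection G} {a : G} (ha : a ∈ U) : inv a ∈ U⁻¹ :=
  ⟨a, ha, rfl⟩

theorem injOn_d (U : CompactBisection G) : Set.InjOn (d : G → UnitSpace G) (U : Set G) :=
  (isBisection_iff.1 U.isBisection).2.1

theorem injOn_r (U : CompactBisection G) : Set.InjOn (r : G → UnitSpace G) (U : Set G) :=
  (isBisection_iff.1 U.isBisection).2.2

variable [T2Space (UnitSpace G)]

theorem mul_mem_mul {U V : CompactBisection G} {a b : G} (ha : a ∈ U) (hb : b ∈ V)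
    (h : d a = r b) : mul a b h ∈ U * V :=
  ⟨a, ha, b, hb, h, rfl⟩

theorem isIdempotentElem_iff_subset_units {U : CompactBisection G} :
    IsIdempotentElem U ↔ (U : Set G) ⊆ units := by
  constructor
  · intro hU a ha
    have ha' : a ∈ U * U := by
      rw [hU.eq]
      exact ha
    obtain ⟨b, hb, c, hc, h, e⟩ := ha'
    have eb : a = b := U.injOn_r ha hb (by rw [e, r_mul'])
    have ec : a = c := U.injOn_d ha hc (by rw [e, d_mul])
    subst eb
    subst ec
    exact mem_units_of_mul_self h e.symm
  · intro hU
    refine SetLike.ext fun x => ⟨?_, fun hx => ?_⟩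
    · rintro ⟨a, ha, b, hb, h, rfl⟩
      have e : a = b := (coe_d_of_mem_units (hU ha)).symm.trans
        ((congrArg Subtype.val h).trans (coe_r_of_mem_units (hU hb)))
      subst e
      rw [mul_self_of_mem_units (hU ha)]
      exact ha
    · have h : d x = r x := Subtype.ext
        ((coe_d_of_mem_units (hU hx)).trans (coe_r_of_mem_units (hU hx)).symm)
      have := mul_mem_mul (U := U) (V := U) hx hx h
      rwa [mul_self_of_mem_units (hU hx)] at this

theorem natLE_iff {U V : CompactBisection G} : NatLE U V ↔ (U : Set G) ⊆ V := by
  constructor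
  · intro h x hx
    have hx' : x ∈ V * U⁻¹ * U := by
      rw [show V * U⁻¹ * U = U from h]
      exact hx
    obtain ⟨_, ⟨v, hv, _, ⟨u, hu, rfl⟩, h1, rfl⟩, u', hu', h2, rfl⟩ := hx'
    have e : u = u' := U.injOn_r hu hu' ((d_inv u).symm.trans ((d_mul _ _ _).symm.trans h2))
    subst e
    rw [mul_inv_mul_cancel_right]
    exact hv
  · intro h
    refine SetLike.ext fun x => ⟨?_, fun hx => ?_⟩
    · rintro ⟨_, ⟨v, hv, _, ⟨u, hu, rfl⟩, h1, rfl⟩, u', hu', h2, rfl⟩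
      have e : u = u' := U.injOn_r hu hu' ((d_inv u).symm.trans ((d_mul _ _ _).symm.trans h2))
      have e' : v = u := V.injOn_d hv (h hu) (h1.trans (r_inv u).symm)
      subst e
      subst e'
      rw [mul_inv_mul_cancel_right]
      exact hu
    · have h2 : d (mul x (inv x) (r_inv x)) = r x := (d_mul _ _ _).trans (d_inv x)
      have := mul_mem_mul (mul_mem_mul (h hx) (inv_mem_inv hx) (r_inv x)) hx h2
      rwa [mul_inv_mul_cancel_right] at this

theorem _root_.InverseSemigroup.Compatible.eq_of_d_eq {U V : CompactBisection G}
    (h : Compatible U V) {a b : G} (ha : a ∈ U) (hb : b ∈ V) (e : d a = d b) : a = b :=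
  eq_of_mul_inv_mem_units (e.trans (r_inv b))
    (isIdempotentElem_iff_subset_units.1 h.2 (mul_mem_mul ha (inv_mem_inv hb) _))

theorem _root_.InverseSemigroup.Compatible.eq_of_r_eq {U V : CompactBisection G}
    (h : Compatible U V) {a b : G} (ha : a ∈ U) (hb : b ∈ V) (e : r a = r b) : a = b :=
  eq_of_inv_mul_mem_units ((d_inv a).trans e)
    (isIdempotentElem_iff_subset_units.1 h.1 (mul_mem_mul (inv_mem_inv ha) hb _))

theorem isJoin_of_coe_eq_union {U V W : CompactBisection G} (h : (W : Set G) = (U : Set G) ∪ V) :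
    IsJoin U V W := by
  refine ⟨natLE_iff.2 ?_, natLE_iff.2 ?_, fun X hU hV => natLE_iff.2 ?_⟩
  · exact h ▸ Set.subset_union_left
  · exact h ▸ Set.subset_union_right
  · exact h ▸ Set.union_subset (natLE_iff.1 hU) (natLE_iff.1 hV)

theorem _root_.InverseSemigroup.Compatible.exists_isJoin_union {U V : CompactBisection G}
    (h : Compatible U V) : ∃ W : CompactBisection G, (W : Set G) = (U : Set G) ∪ V ∧ IsJoin U V W := by
  have hB : IsBisection ((U : Set G) ∪ V) := by
    refine isBisection_iff.2 ⟨U.isOpen_coe.union V.isOpen_coe, ?_, ?_⟩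
    · rintro a (ha | ha) b (hb | hb) e
      · exact U.injOn_d ha hb e
      · exact h.eq_of_d_eq ha hb e
      · exact (h.eq_of_d_eq hb ha e.symm).symm
      · exact V.injOn_d ha hb e
    · rintro a (ha | ha) b (hb | hb) e
      · exact U.injOn_r ha hb e
      · exact h.eq_of_r_eq ha hb e
      · exact (h.eq_of_r_eq hb ha e.symm).symm
      · exact V.injOn_r ha hb e
  exact ⟨⟨(U : Set G) ∪ V, U.isCompact.union V.isCompact, hB⟩, rfl, isJoin_of_coe_eq_union rfl⟩

theorem compatible_of_subset {U V W : CompactBisection G} (hU : (U : Set G) ⊆ W)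
    (hV : (V : Set G) ⊆ W) : Compatible U V := by
  refine ⟨isIdempotentElem_iff_subset_units.2 ?_, isIdempotentElem_iff_subset_units.2 ?_⟩
  · rintro _ ⟨_, ⟨a, ha, rfl⟩, b, hb, h, rfl⟩
    have e : a = b := W.injOn_r (hU ha) (hV hb) ((d_inv a).symm.trans h)
    subst e
    rw [inv_mul]
    exact (d a).2
  · rintro _ ⟨a, ha, _, ⟨b, hb, rfl⟩, h, rfl⟩
    have e : a = b := W.injOn_d (hU ha) (hV hb) (h.trans (r_inv b).symm)
    subst e
    rw [ArrowGroupoid.mul_inv]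
    exact (r a).2

/-- A wide subsemigroup is an order ideal, since `W = V (W⁻¹ W)` for `W ⊆ V`. -/
theorem mem_of_subset_of_mem {T : InverseSubsemigroup (CompactBisection G)} (hT : T.IsWide)
    {W V : CompactBisection G} (hWV : (W : Set G) ⊆ V) (hV : V ∈ T) : W ∈ T := by
  have e : V * (W⁻¹ * W) = W := (mul_assoc _ _ _).symm.trans (natLE_iff.2 hWV)
  have hi : IsIdempotentElem (W⁻¹ * W) := by
    change W⁻¹ * W * (W⁻¹ * W) = W⁻¹ * W
    rw [← mul_assoc, InverseSemigroup.inv_mul_inv]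
  rw [← e]
  exact T.mul_mem' hV (hT _ hi)

theorem mem_of_subset_iUnion {G : Type*} [TopologicalSpace G] [ArrowGroupoid G] [AmpleGroupoid G]
    [T2Space (UnitSpace G)] {T : InverseSubsemigroup (CompactBisection G)} (hT : T.IsWide)
    (hJ : T.IsJoinClosed) {U : CompactBisection G} (hU : (U : Set G) ⊆ ⋃ V ∈ T, (V : Set G)) :
    U ∈ T := by
  have key : ∃ W ∈ T, (U : Set G) ⊆ W ∧ (W : Set G) ⊆ U := by
    -- Compactness of `U`, applied to the property of being covered by some `W ∈ T` inside `U`.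
    refine IsCompact.induction_on (p := fun s => ∃ W ∈ T, s ⊆ (W : Set G) ∧ (W : Set G) ⊆ U)
      U.isCompact ?_ ?_ ?_ ?_
    · exact ⟨0, hT 0 (mul_zero 0), Set.empty_subset _, Set.empty_subset _⟩
    · rintro s t hst ⟨W, hW, htW, hWU⟩
      exact ⟨W, hW, hst.trans htW, hWU⟩
    · rintro s t ⟨W, hW, hsW, hWU⟩ ⟨X, hX, htX, hXU⟩
      have hc := compatible_of_subset hWU hXU
      obtain ⟨Y, hY, hj⟩ := hc.exists_isJoin_union
      refine ⟨Y, hJ W hW X hX hc Y hj, ?_, ?_⟩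
      · rw [hY]
        exact Set.union_subset_union hsW htX
      · rw [hY]
        exact Set.union_subset hWU hXU
    · intro x hx
      obtain ⟨V, hV, hxV⟩ := Set.mem_iUnion₂.1 (hU hx)
      obtain ⟨W, hxW, hWO⟩ := AmpleGroupoid.exists_compactBisection
        (U.isOpen_coe.inter V.isOpen_coe) ⟨hx, hxV⟩
      exact ⟨W, mem_nhdsWithin_of_mem_nhds (W.isOpen_coe.mem_nhds hxW), W,
        mem_of_subset_of_mem hT (fun a ha => (hWO ha).2) hV, subset_rfl, fun a ha => (hWO ha).1⟩
  obtain ⟨W, hW, h1, h2⟩ := key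
  rwa [SetLike.coe_injective (h1.antisymm h2)]

end CompactBisection

/-! ### The two maps of the correspondence -/

namespace ArrowSubgroupoid

open ArrowGroupoid InverseSemigroup CompactBisection

variable {G : Type*} [TopologicalSpace G] [ArrowGroupoid G] [EtaleGroupoid G]
  [T2Space (UnitSpace G)]

/-- The subsemigroup of `I(G)` formed by the compact bisections contained in `H`. -/
def toInverseSubsemigroup (H : ArrowSubgroupoid G) :
    InverseSubsemigroup (CompactBisection G) where
  carrier := {U | (U : Set G) ⊆ H}
  mul_mem' := by
    rintro U V hU hV _ ⟨a, ha, b, hb, h, rfl⟩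
    exact H.mul_mem h (hU ha) (hV hb)
  inv_mem' := by
    rintro U hU _ ⟨a, ha, rfl⟩
    exact H.inv_mem (hU ha)

theorem mem_toInverseSubsemigroup {H : ArrowSubgroupoid G} {U : CompactBisection G} :
    U ∈ H.toInverseSubsemigroup ↔ (U : Set G) ⊆ H := Iff.rfl

theorem IsWide.toInverseSubsemigroup {H : ArrowSubgroupoid G} (hH : H.IsWide) :
    H.toInverseSubsemigroup.IsWide := fun _ he =>
  mem_toInverseSubsemigroup.2 ((isIdempotentElem_iff_subset_units.1 he).trans hH)

theorem isJoinClosed_toInverseSubsemigroup (H : ArrowSubgroupoid G) :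
    H.toInverseSubsemigroup.IsJoinClosed := by
  intro U hU V hV hc W hW
  obtain ⟨X, hX, hUX, hVX, -⟩ := hc.exists_isJoin_union
  refine mem_toInverseSubsemigroup.2 ((natLE_iff.1 (hW.2.2 X hUX hVX)).trans ?_)
  rw [hX]
  exact Set.union_subset hU hV

end ArrowSubgroupoid

namespace InverseSubsemigroup

open ArrowGroupoid EtaleGroupoid CompactBisection

variable {G : Type*} [TopologicalSpace G] [ArrowGroupoid G]

/-- The subgroupoid of `G` formed by the union of the compact bisections in `T`. -/
def toArrowSubgroupoid [EtaleGroupoid G] [T2Space (UnitSpace G)]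
    (T : InverseSubsemigroup (CompactBisection G)) : ArrowSubgroupoid G where
  carrier := ⋃ U ∈ T, (U : Set G)
  mul_mem := by
    intro a b h ha hb
    obtain ⟨U, hU, ha⟩ := Set.mem_iUnion₂.1 ha
    obtain ⟨V, hV, hb⟩ := Set.mem_iUnion₂.1 hb
    exact Set.mem_iUnion₂.2 ⟨U * V, T.mul_mem' hU hV, mul_mem_mul ha hb h⟩
  inv_mem := by
    intro a ha
    obtain ⟨U, hU, ha⟩ := Set.mem_iUnion₂.1 ha
    exact Set.mem_iUnion₂.2 ⟨U⁻¹, T.inv_mem' hU, inv_mem_inv ha⟩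

theorem coe_toArrowSubgroupoid [EtaleGroupoid G] [T2Space (UnitSpace G)]
    (T : InverseSubsemigroup (CompactBisection G)) :
    (T.toArrowSubgroupoid : Set G) = ⋃ U ∈ T, (U : Set G) := rfl

theorem isOpen_toArrowSubgroupoid [EtaleGroupoid G] [T2Space (UnitSpace G)]
    (T : InverseSubsemigroup (CompactBisection G)) : IsOpen (T.toArrowSubgroupoid : Set G) :=
  isOpen_biUnion fun U _ => U.isOpen_coe

theorem IsWide.toArrowSubgroupoid [AmpleGroupoid G] [T2Space (UnitSpace G)]
    {T : InverseSubsemigroup (CompactBisection G)} (hT : T.IsWide) :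
    T.toArrowSubgroupoid.IsWide := by
  intro x hx
  obtain ⟨U, hxU, hU⟩ := AmpleGroupoid.exists_compactBisection isOpen_units hx
  exact Set.mem_iUnion₂.2 ⟨U, hT U (isIdempotentElem_iff_subset_units.2 hU), hxU⟩

end InverseSubsemigroup

theorem mainTheorem3 {G : Type*} [TopologicalSpace G] [ArrowGroupoid G] [AmpleGroupoid G]
    [T2Space (UnitSpace G)] :
    ∃ Φ : {H : ArrowSubgroupoid G // IsOpen (H : Set G) ∧ H.IsWide} ≃
        {T : InverseSubsemigroup (CompactBisection G) // T.IsWide ∧ T.IsJoinClosed},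
      (∀ H, ∀ U : CompactBisection G, U ∈ (Φ H).1 ↔ (U : Set G) ⊆ (H.1 : Set G)) ∧
      (∀ T, ((Φ.symm T).1 : Set G) = ⋃ U ∈ T.1, (U : Set G)) := by
  refine ⟨{
    toFun := fun H => ⟨H.1.toInverseSubsemigroup, H.2.2.toInverseSubsemigroup,
      H.1.isJoinClosed_toInverseSubsemigroup⟩
    invFun := fun T => ⟨T.1.toArrowSubgroupoid, T.1.isOpen_toArrowSubgroupoid,
      T.2.1.toArrowSubgroupoid⟩
    left_inv := ?_
    right_inv := ?_ }, fun H U => Iff.rfl, fun T => rfl⟩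
  · rintro ⟨H, hHo, hHw⟩
    refine Subtype.ext (SetLike.coe_injective (Set.Subset.antisymm ?_ fun x hx => ?_))
    · exact Set.iUnion₂_subset fun U hU => hU
    · obtain ⟨U, hxU, hUH⟩ := AmpleGroupoid.exists_compactBisection hHo hx
      exact Set.mem_iUnion₂.2 ⟨U, hUH, hxU⟩
  · rintro ⟨T, hTw, hTj⟩
    refine Subtype.ext (SetLike.ext fun U => ⟨fun hU => ?_, fun hU => ?_⟩)
    · exact CompactBisection.mem_of_subset_iUnion hTw hTj hU
    · exact Set.subset_biUnion_of_mem (u := fun V : CompactBisection G => (V : Set G)) hU
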